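/- Let $E$ be a complex Banach algebra with identity (not necessarily commutative) and $\dim_{\mathbb C} E>1$. Let $\mathcal H_b(E,E)$ be the space of all holomorphic maps $f:E\to E$ of bounded type, that is, maps that are analytic on all of $E$ and bounded on every bounded subset of $E$, endowed with the topology of uniform convergence on the bounded subsets of $E$. A map $f:E\to E$ is called Lorch-analytic if for every $\omega\in E$ there exists $\zeta\in E$ such that $$\lim_{h\to 0}\frac{\|f(\omega+h)-f(\omega)-\zeta\cdot h\|}{\|h\|}=0,$$ and $\mathcal H_L(E,E)$ denotes the set of all Lorch-analytic maps $E\to E$. Then the set $\mathcal G_b(E)=\mathcal H_b(E,E)\setminus\mathcal H_L(E,E)$ is spaceable in $\mathcal H_b(E,E)$: there is a closed infinite-dimensional vector subspace of $\mathcal H_b(E,E)$ contained in $\mathcal G_b(E)\cup\{0\}$. -/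

import Mathlib

open Filter Topology

noncomputable section

/-- `A ⊆ Y` is spaceable: `A ∪ {0}` contains a closed infinite dimensional vector subspace of
the complex topological vector space `Y`. -/
def IsSpaceable {Y : Type*} [AddCommGroup Y] [Module ℂ Y] [TopologicalSpace Y]
    [IsTopologicalAddGroup Y] [ContinuousSMul ℂ Y] (A : Set Y) : Prop :=
  ∃ S : Submodule ℂ Y, IsClosed (S : Set Y) ∧ ¬ FiniteDimensional ℂ S ∧ (S : Set Y) ⊆ A ∪ {0}

/-- `ζ` is a derivative of `f` at `ω` in the sense of Lorch. -/
def HasLorchDerivAt {E : Type*} [NormedRing E] (f : E → E) (ζ ω : E) : Prop :=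
  Tendsto (fun h : E => ‖f (ω + h) - f ω - ζ * h‖ / ‖h‖) (𝓝[≠] 0) (𝓝 0)

/-- `f` is Lorch-analytic in `E`: it has a derivative in the sense of Lorch at every point. -/
def IsLorchAnalytic {E : Type*} [NormedRing E] (f : E → E) : Prop :=
  ∀ ω : E, ∃ ζ : E, HasLorchDerivAt f ζ ω

/-- All maps `E → E`, with the topology of uniform convergence on bounded subsets of `E`. -/
abbrev BddConvFun (E : Type*) [NormedRing E] : Type _ :=
  UniformOnFun E E {s : Set E | Bornology.IsBounded s}

/-- The map underlying an element of `BddConvFun E`. -/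
abbrev BddConvFun.toMap {E : Type*} [NormedRing E] (f : BddConvFun E) : E → E :=
  UniformOnFun.toFun {s : Set E | Bornology.IsBounded s} f

/-- `𝓗_b(E, E)`: the holomorphic maps `E → E` of bounded type, that is, those which are analytic
on the whole of `E` and bounded on every bounded subset of `E`. As a subspace of `BddConvFun E`
it carries the topology of uniform convergence on bounded sets. -/
def Hb (E : Type*) [NormedRing E] [NormedAlgebra ℂ E] : Submodule ℂ (BddConvFun E) where
  carrier := {f | AnalyticOnNhd ℂ f.toMap Set.univ ∧
    ∀ s : Set E, Bornology.IsBounded s → Bornology.IsBounded (f.toMap '' s)}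
  zero_mem' := by
    refine ⟨fun x _ => analyticAt_const (v := (0 : E)), fun s _ => ?_⟩
    refine (Bornology.isBounded_singleton (x := (0 : E))).subset ?_
    rintro _ ⟨x, _, rfl⟩
    rfl
  add_mem' := by
    rintro f g ⟨hf, hf'⟩ ⟨hg, hg'⟩
    refine ⟨hf.add hg, fun s hs => ((hf' s hs).add (hg' s hs)).subset ?_⟩
    rintro _ ⟨x, hx, rfl⟩
    exact Set.add_mem_add ⟨x, hx, rfl⟩ ⟨x, hx, rfl⟩
  smul_mem' := by
    rintro c f ⟨hf, hf'⟩
    refine ⟨fun x hx => (hf x hx).const_smul (c := c), fun s hs => ((hf' s hs).smul₀ c).subset ?_⟩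
    rintro _ ⟨x, hx, rfl⟩
    exact Set.smul_mem_smul_set ⟨x, hx, rfl⟩

instance Hb.instContinuousSMul (E : Type*) [NormedRing E] [NormedAlgebra ℂ E] :
    ContinuousSMul ℂ (Hb E) :=
  UniformOnFun.continuousSMul_induced_of_image_bounded ℂ E E (Hb E)
    (φ := (Hb E).subtype) ⟨rfl⟩
    (fun f s hs => (NormedSpace.isVonNBounded_iff ℂ).2 (f.2.2 s hs))

/-- `𝓖_b(E) = 𝓗_b(E, E) \ 𝓗_L(E, E)`, as a subset of `𝓗_b(E, E)`. -/
def Gb (E : Type*) [NormedRing E] [NormedAlgebra ℂ E] : Set (Hb E) :=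
  {f | ¬ IsLorchAnalytic (f : BddConvFun E).toMap}

end

/-! Fix a continuous functional `φ` with `φ 1 = 0`, `φ e = 1`, and take the maps in `Hb E` that
vanish at `0` and factor through `φ`. They are constant along `ℂ • 1`, so testing a Lorch derivative
on `h = t • 1` forces it to be `0`; a Lorch-analytic one then has zero Fréchet derivative
everywhere, hence is `0` (`IsLorchAnalytic.eq_of_const`). The subspace is cut out by pointwise
equations, hence closed, and contains `p (φ x) • 1` for every polynomial `p` with `p 0 = 0`. -/

/-- In a complex normed algebra of dimension greater than one some continuous linear functional
vanishes at `1` and takes the value `1` at some point. -/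
theorem exists_dual_map_one_eq_zero {E : Type*} [NormedRing E] [NormedAlgebra ℂ E]
    (hE : 1 < Module.rank ℂ E) : ∃ (φ : E →L[ℂ] ℂ) (e : E), φ 1 = 0 ∧ φ e = 1 := by
  have hnt : Nontrivial E := rank_pos_iff_nontrivial.1 (zero_lt_one.trans hE)
  obtain ⟨ψ, hψ⟩ := SeparatingDual.exists_eq_one (R := ℂ) (one_ne_zero (α := E))
  obtain ⟨e, he⟩ : ∃ e : E, e - ψ e • (1 : E) ≠ 0 := by
    by_contra! h
    exact hE.not_ge (rank_le_one_iff.2 ⟨1, fun v => ⟨ψ v, (sub_eq_zero.1 (h v)).symm⟩⟩)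
  obtain ⟨χ, hχ⟩ := SeparatingDual.exists_eq_one (R := ℂ) he
  -- Its value at `e` is `χ (e - ψ e • 1) = 1`.
  refine ⟨χ - χ 1 • ψ, e, by simp [hψ], ?_⟩
  simpa [mul_comm] using hχ

/-- If `f` is constant along the direction `1`, then its only possible Lorch derivative is `0`. -/
theorem HasLorchDerivAt.eq_zero_of_const {E : Type*} [NormedRing E] [NormedAlgebra ℂ E]
    {f : E → E} {ζ ω : E} (h : HasLorchDerivAt f ζ ω)
    (hf : ∀ t : ℂ, f (ω + t • (1 : E)) = f ω) : ζ = 0 := by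
  nontriviality E
  have ht : Tendsto (fun t : ℂ => t • (1 : E)) (𝓝[≠] 0) (𝓝[≠] 0) := by
    refine tendsto_nhdsWithin_iff.2 ⟨?_, ?_⟩
    · exact (Continuous.tendsto' (by fun_prop) 0 0 (by simp)).mono_left nhdsWithin_le_nhds
    · filter_upwards [self_mem_nhdsWithin] with t ht
      exact smul_ne_zero ht one_ne_zero
  have hc : Tendsto (fun _ : ℂ => ‖ζ‖ / ‖(1 : E)‖) (𝓝[≠] 0) (𝓝 0) := by
    refine (Tendsto.comp h ht).congr' ?_
    filter_upwards [self_mem_nhdsWithin] with t ht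
    have ht' : ‖t‖ ≠ 0 := norm_ne_zero_iff.2 ht
    simp [hf, norm_smul, mul_div_mul_left _ _ ht']
  have := tendsto_nhds_unique tendsto_const_nhds hc
  simpa using this

theorem HasLorchDerivAt.hasFDerivAt_zero {E : Type*} [NormedRing E] [NormedAlgebra ℂ E]
    {f : E → E} {ω : E} (h : HasLorchDerivAt f 0 ω) : HasFDerivAt f (0 : E →L[ℂ] E) ω := by
  rw [hasFDerivAt_iff_isLittleO_nhds_zero, ← Asymptotics.isLittleO_norm_norm,
    Asymptotics.isLittleO_iff_tendsto' (Eventually.of_forall fun x hx => by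
      simp [norm_eq_zero.1 hx])]
  have h' : Tendsto (fun x : E => ‖f (ω + x) - f ω - (0 : E →L[ℂ] E) x‖ / ‖x‖) (𝓝[≠] 0) (𝓝 0) := by
    simpa [HasLorchDerivAt] using h
  -- At the added point `0` the quotient is `0 / 0 = 0`.
  rw [← nhdsNE_sup_pure, tendsto_sup]
  exact ⟨h', (tendsto_pure_nhds _ _).trans_eq (by simp)⟩

/-- A Lorch-analytic map that is invariant under translation by scalars is constant. -/
theorem IsLorchAnalytic.eq_of_const {E : Type*} [NormedRing E] [NormedAlgebra ℂ E]
    {f : E → E} (h : IsLorchAnalytic f) (hf : ∀ (ω : E) (t : ℂ), f (ω + t • (1 : E)) = f ω)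
    (x y : E) : f x = f y := by
  have hd : ∀ ω, HasFDerivAt f (0 : E →L[ℂ] E) ω := fun ω => by
    obtain ⟨ζ, hζ⟩ := h ω
    obtain rfl := hζ.eq_zero_of_const (hf ω)
    exact hζ.hasFDerivAt_zero
  exact is_const_of_fderiv_eq_zero (𝕜 := ℂ) (fun ω => (hd ω).differentiableAt)
    (fun ω => (hd ω).fderiv) x y

/-- The maps in `𝓗_b(E, E)` that vanish at `0` and factor through the functional `φ`, where
`φ e = 1`. -/
def Hb.factoring {E : Type*} [NormedRing E] [NormedAlgebra ℂ E] (φ : E →L[ℂ] ℂ) (e : E) :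
    Submodule ℂ (Hb E) where
  carrier := {f | (f : BddConvFun E).toMap 0 = 0 ∧
    ∀ x, (f : BddConvFun E).toMap x = (f : BddConvFun E).toMap (φ x • e)}
  zero_mem' := ⟨rfl, fun _ => rfl⟩
  add_mem' := by
    rintro f g ⟨hf, hf'⟩ ⟨hg, hg'⟩
    exact ⟨(congrArg₂ (· + ·) hf hg).trans (add_zero 0),
      fun x => congrArg₂ (· + ·) (hf' x) (hg' x)⟩
  smul_mem' := by
    rintro c f ⟨hf, hf'⟩
    exact ⟨(congrArg (c • ·) hf).trans (smul_zero c), fun x => congrArg (c • ·) (hf' x)⟩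

theorem Hb.continuous_eval {E : Type*} [NormedRing E] [NormedAlgebra ℂ E] (x : E) :
    Continuous fun f : Hb E => (f : BddConvFun E).toMap x :=
  (UniformOnFun.uniformContinuous_eval_of_mem E {s : Set E | Bornology.IsBounded s}
    (Set.mem_singleton x) Bornology.isBounded_singleton).continuous.comp continuous_subtype_val

theorem Hb.isClosed_factoring {E : Type*} [NormedRing E] [NormedAlgebra ℂ E] (φ : E →L[ℂ] ℂ)
    (e : E) : IsClosed (Hb.factoring φ e : Set (Hb E)) := by
  have : (Hb.factoring φ e : Set (Hb E)) = {f : Hb E | (f : BddConvFun E).toMap 0 = 0} ∩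
      ⋂ x, {f : Hb E | (f : BddConvFun E).toMap x = (f : BddConvFun E).toMap (φ x • e)} := by
    ext f
    simp [Hb.factoring]
  rw [this]
  exact (isClosed_eq (Hb.continuous_eval 0) continuous_const).inter
    (isClosed_iInter fun x => isClosed_eq (Hb.continuous_eval x) (Hb.continuous_eval _))

/-- The map `x ↦ p (φ x) • 1` as an element of `𝓗_b(E, E)`. -/
noncomputable def Hb.ofPolynomial {E : Type*} [NormedRing E] [NormedAlgebra ℂ E] (φ : E →L[ℂ] ℂ) :
    Polynomial ℂ →ₗ[ℂ] Hb E where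
  toFun p := ⟨UniformOnFun.ofFun _ fun x => p.eval (φ x) • (1 : E), by
    refine ⟨fun x _ => ?_, fun s hs => ?_⟩
    · exact ((AnalyticOnNhd.eval_polynomial p (φ x) trivial).comp (φ.analyticAt x)).smul
        analyticAt_const
    -- Bounded subsets of `ℂ` are relatively compact, even if those of `E` are not.
    · have hφ : IsCompact (closure (φ '' s)) := (hs.image φ).isCompact_closure
      have hc : Continuous fun z : ℂ => p.eval z • (1 : E) := by fun_prop
      refine (hφ.image hc).isBounded.subset ?_
      rintro _ ⟨x, hx, rfl⟩
      exact ⟨φ x, subset_closure ⟨x, hx, rfl⟩, rfl⟩⟩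
  map_add' p q := Subtype.ext <| funext fun x => by
    change (p + q).eval (φ x) • (1 : E) = p.eval (φ x) • (1 : E) + q.eval (φ x) • (1 : E)
    rw [Polynomial.eval_add, add_smul]
  map_smul' c p := Subtype.ext <| funext fun x => by
    change (c • p).eval (φ x) • (1 : E) = c • (p.eval (φ x) • (1 : E))
    rw [Polynomial.eval_smul, smul_assoc]

theorem Hb.toMap_ofPolynomial {E : Type*} [NormedRing E] [NormedAlgebra ℂ E] (φ : E →L[ℂ] ℂ)
    (p : Polynomial ℂ) (x : E) :
    (Hb.ofPolynomial φ p : BddConvFun E).toMap x = p.eval (φ x) • (1 : E) :=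
  rfl

theorem not_finiteDimensional_of_polynomial_injective {V : Type*} [AddCommGroup V] [Module ℂ V]
    {T : Polynomial ℂ →ₗ[ℂ] V} (hT : Function.Injective T) : ¬ FiniteDimensional ℂ V :=
  fun _ => Polynomial.not_finite (Module.Finite.of_injective T hT)

/-- The factor `X` secures the vanishing at `0`; injectivity holds because `φ (z • e) = z` recovers
every value of the polynomial. -/
theorem Hb.not_finiteDimensional_factoring {E : Type*} [NormedRing E] [NormedAlgebra ℂ E]
    [Nontrivial E] {φ : E →L[ℂ] ℂ} {e : E} (he : φ e = 1) :
    ¬ FiniteDimensional ℂ (Hb.factoring φ e) := by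
  let T : Polynomial ℂ →ₗ[ℂ] Hb.factoring φ e :=
    ((Hb.ofPolynomial φ).comp (LinearMap.mulLeft ℂ Polynomial.X)).codRestrict _ fun p => by
      refine ⟨?_, fun x => ?_⟩
      · simp [Hb.toMap_ofPolynomial]
      · simp [Hb.toMap_ofPolynomial, he]
  have hT : Function.Injective T := by
    refine (injective_iff_map_eq_zero T).2 fun p hp => ?_
    have h0 : Polynomial.X * p = 0 := Polynomial.funext fun z => by
      have h : (Polynomial.X * p).eval (φ (z • e)) • (1 : E) = 0 :=
        congrArg (fun f : Hb.factoring φ e => ((f : Hb E) : BddConvFun E).toMap (z • e)) hp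
      simpa only [map_smul, he, smul_eq_mul, mul_one, Polynomial.eval_zero, smul_eq_zero,
        one_ne_zero, or_false] using h
    exact (mul_eq_zero.1 h0).resolve_left Polynomial.X_ne_zero
  exact not_finiteDimensional_of_polynomial_injective hT

theorem mainTheorem6 {E : Type*} [NormedRing E] [NormedAlgebra ℂ E] [CompleteSpace E]
    (hE : 1 < Module.rank ℂ E) : IsSpaceable (Gb E) := by
  have hnt : Nontrivial E := rank_pos_iff_nontrivial.1 (zero_lt_one.trans hE)
  obtain ⟨φ, e, h1, he⟩ := exists_dual_map_one_eq_zero hE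
  refine ⟨Hb.factoring φ e, Hb.isClosed_factoring φ e, Hb.not_finiteDimensional_factoring he, ?_⟩
  rintro f ⟨hf0, hf⟩
  rw [Set.mem_union, or_iff_not_imp_left]
  intro hL
  have hL' : IsLorchAnalytic (f : BddConvFun E).toMap := not_not.1 hL
  refine Subtype.ext <| funext fun x => ?_
  refine (hL'.eq_of_const (fun ω t => ?_) x 0).trans hf0
  rw [hf, hf ω]
  simp [h1]
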